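/- Let $d \ge 0$, and let $\varphi_1,\dots,\varphi_m : \mathbb{R}^d \to \mathbb{R}^d$ ($m \ge 1$) be similitudes, that is, for each $i$ there is $\beta_i \in (0,1)$ with $|\varphi_i(u)-\varphi_i(v)| = \beta_i |u-v|$ for all $u,v \in \mathbb{R}^d$ (rotations and reflections are allowed). Let $C \subset \mathbb{R}^d$ be the self-similar set generated by them, i.e. the unique non-empty compact set with $C = \bigcup_{i=1}^m \varphi_i(C)$, and assume the strong separation condition: $\varphi_i(C) \cap \varphi_j(C) = \emptyset$ for $i \ne j$. Let $s = \dim_H C$ be the Hausdorff dimension of $C$, let $\mathcal{H}^s$ be the $s$-dimensional Hausdorff measure, and let $\mu = \mathcal{H}^s\lfloor_C$ be its restriction to $C$. Then for every $x \in C$, $$\operatorname{Tan}(\mu,x) = \{\, c\,\mathcal{H}^s\lfloor_F \;:\; F \in \omega(C^x),\ c > 0 \,\}.$$ Here $\operatorname{Tan}(\mu,x)$, the set of tangent measures of $\mu$ at $x$, consists of all non-zero Radon measures $\nu$ on $\mathbb{R}^d$ for which there are positive numbers $c_k$ and $r_k$ with $r_k \to 0$ such that $c_k\,\mu_{x,r_k}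 \to \nu$ weakly, where $\mu_{x,r}(A) = \mu(x + rA)$, and weak convergence $\mu_k \to \nu$ of Radon measures means $\int f\,d\mu_k \to \int f\,d\nu$ for all continuous compactly supported $f : \mathbb{R}^d \to \mathbb{R}$. Further, $\omega(C^x)$, the set of limit models of $C$ at $x$, consists of all closed sets $F \subset \mathbb{R}^d$ for which there are positive numbers $r_k \to 0$ such that $(C - x)/r_k \to F$ in the Fell (hit-and-miss) topology, that is, the topology on the set of closed subsets of $\mathbb{R}^d$ generated by the families $\{F : F \cap K = \emptyset\}$ ($K$ compact) and $\{F : F \cap G \neq \emptyset\}$ ($G$ open). -/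

import Mathlib

open Set Filter Topology MeasureTheory TopologicalSpace
open scoped NNReal

/-- A (contracting) similitude of `ℝ^d`: `|φ x - φ y| = r |x - y|` for some ratio `0 < r < 1`.
Rotations and reflections are allowed. -/
def IsSimilitude {d : ℕ} (φ : EuclideanSpace ℝ (Fin d) → EuclideanSpace ℝ (Fin d)) : Prop :=
  ∃ r : ℝ, 0 < r ∧ r < 1 ∧ ∀ x y, dist (φ x) (φ y) = r * dist x y

/-- `C` is the self-similar set generated by the iterated function system `φ`: a non-empty compact
set which is the union of its images. -/
def IsSelfSimilarSet {d m : ℕ} (φ : Fin m → EuclideanSpace ℝ (Fin d) → EuclideanSpace ℝ (Fin d))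
    (C : NonemptyCompacts (EuclideanSpace ℝ (Fin d))) : Prop :=
  (∀ i, IsSimilitude (φ i)) ∧ (C : Set (EuclideanSpace ℝ (Fin d))) = ⋃ i, φ i '' C

/-- Strong separation condition: the pieces `φ i (C)` are pairwise disjoint. -/
def StrongSeparation {d m : ℕ} (φ : Fin m → EuclideanSpace ℝ (Fin d) → EuclideanSpace ℝ (Fin d))
    (C : NonemptyCompacts (EuclideanSpace ℝ (Fin d))) : Prop :=
  ∀ i j, i ≠ j →
    Disjoint (φ i '' (C : Set (EuclideanSpace ℝ (Fin d)))) (φ j '' C)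

/-- The Fell (hit-and-miss) topology on the closed subsets (including `∅`) of a space: it is
generated by `{F | F ∩ K = ∅}`, `K` compact, and `{F | F ∩ G ≠ ∅}`, `G` open. -/
@[reducible] def fellTopology (X : Type*) [TopologicalSpace X] : TopologicalSpace (Closeds X) :=
  generateFrom
    ({U | ∃ K : Set X, IsCompact K ∧ U = {F : Closeds X | (F : Set X) ∩ K = ∅}} ∪
      {U | ∃ G : Set X, IsOpen G ∧ U = {F : Closeds X | ((F : Set X) ∩ G).Nonempty}})

/-- The blow-up `(G - x) / r` of a closed set `G`. -/
noncomputable def blowUpSet {d : ℕ} (G : Closeds (EuclideanSpace ℝ (Fin d)))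
    (x : EuclideanSpace ℝ (Fin d)) (r : ℝ) : Closeds (EuclideanSpace ℝ (Fin d)) where
  carrier := (fun y => r⁻¹ • (y - x)) '' (G : Set (EuclideanSpace ℝ (Fin d)))
  isClosed' := by
    rcases eq_or_ne r 0 with rfl | hr
    · apply Set.Subsingleton.isClosed
      rintro _ ⟨y, -, rfl⟩ _ ⟨z, -, rfl⟩
      simp
    · exact ((Homeomorph.subRight x).trans
        (Homeomorph.smulOfNeZero r⁻¹ (inv_ne_zero hr))).isClosedMap _ G.isClosed

/-- The limit models `ω(G^x)` of a closed set `G` at `x`: all Fell limits of blow-ups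
`(G - x) / r_k` with `r_k > 0`, `r_k → 0`. -/
def limitModels {d : ℕ} (G : Closeds (EuclideanSpace ℝ (Fin d)))
    (x : EuclideanSpace ℝ (Fin d)) : Set (Closeds (EuclideanSpace ℝ (Fin d))) :=
  {F | ∃ r : ℕ → ℝ, (∀ k, 0 < r k) ∧ Tendsto r atTop (𝓝 0) ∧
    Tendsto (fun k => blowUpSet G x (r k)) atTop (@nhds _ (fellTopology _) F)}

/-- Weak convergence of Radon measures on `ℝ^d`, tested on compactly supported continuous
functions. Mathlib's `Measure.Regular` is the notion of a Radon measure. -/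
def RadonWeakLimit {d : ℕ} (μs : ℕ → Measure (EuclideanSpace ℝ (Fin d)))
    (ν : Measure (EuclideanSpace ℝ (Fin d))) : Prop :=
  (∀ n, (μs n).Regular) ∧ ν.Regular ∧
    ∀ f : EuclideanSpace ℝ (Fin d) → ℝ, Continuous f → HasCompactSupport f →
      Tendsto (fun n => ∫ y, f y ∂(μs n)) atTop (𝓝 (∫ y, f y ∂ν))

/-- The measure `μ_{a,r}`, `μ_{a,r}(A) = μ(a + r A)` for `r > 0`, as the image of `μ` under
`y ↦ (y - a) / r`. -/
noncomputable def blowUpMeasure {d : ℕ} (μ : Measure (EuclideanSpace ℝ (Fin d)))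
    (a : EuclideanSpace ℝ (Fin d)) (r : ℝ) : Measure (EuclideanSpace ℝ (Fin d)) :=
  μ.map (fun y => r⁻¹ • (y - a))

/-- `Tan(μ, a)`: the non-zero Radon measures that are weak limits of `c_k μ_{a,r_k}` with
`c_k > 0`, `r_k > 0`, `r_k → 0`. -/
def tangentMeasures {d : ℕ} (μ : Measure (EuclideanSpace ℝ (Fin d)))
    (a : EuclideanSpace ℝ (Fin d)) : Set (Measure (EuclideanSpace ℝ (Fin d))) :=
  {ν | ν ≠ 0 ∧ ∃ (r : ℕ → ℝ) (c : ℕ → ℝ≥0), (∀ k, 0 < r k) ∧ (∀ k, 0 < c k) ∧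
    Tendsto r atTop (𝓝 0) ∧ RadonWeakLimit (fun k => c k • blowUpMeasure μ a (r k)) ν}

/-! Strong separation isolates each cylinder by a distance proportional to its ratio. Hence, at
small scales `r`, the part of `C` in the ball of radius `R * r` about `x` lies in a single cylinder
of comparable size. In a fixed ball about `0`, every late blow-up thus agrees with a similar copy of
`C` through `0` whose ratio stays in a compact subinterval of `(0, ∞)`
(`SeparatedIFS.hasLocalCopies_blowUpSet`). Such similarities form a precompact family by
Arzelà–Ascoli, and `μH[s]` scales by the ratio to the power `s`. So Fell convergence of the blown-up
sets forces weak convergence of `μH[s]` restricted to them (`HasLocalCopies.tendsto_integral`).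

A blow-up of the measure is `r ^ s` times `μH[s]` on the blown-up set, so every limit model yields
tangent measures once this factor is divided out. Conversely, given a tangent measure, Fell
compactness provides a limit model along a subsequence; both the normalised measures and their
rescalings then converge to nonzero limits, which must be proportional
(`exists_eq_smul_of_tendsto_smul`).

All this needs `μH[s]` on `C` to be finite and positive on open sets. Covering by cylinders and a
Frostman measure give this for the root `s` of `∑ i, ratio i ^ s = 1`, and thereby identify `s` with
the Hausdorff dimension. -/

/-- An iterated function system of contracting similarities of a metric space `K`, whose images
cover `K` and have pairwise distance at least `gap`. -/
structure SeparatedIFS (ι K : Type*) [MetricSpace K] where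
  map : ι → K → K
  ratio : ι → ℝ
  ratio_pos : ∀ i, 0 < ratio i
  ratio_lt_one : ∀ i, ratio i < 1
  dist_map : ∀ i x y, dist (map i x) (map i y) = ratio i * dist x y
  exists_map_eq : ∀ x, ∃ i y, map i y = x
  gap : ℝ
  gap_pos : 0 < gap
  gap_le : ∀ i j, i ≠ j → ∀ x y, gap ≤ dist (map i x) (map j y)

/-! ### Cylinders and their separation -/

namespace SeparatedIFS

variable {ι K : Type*} [MetricSpace K] (S : SeparatedIFS ι K)

/-- The composition of the maps of the system along a word. -/
def word : List ι → K → K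
  | [] => id
  | i :: l => S.map i ∘ word l

/-- The similarity ratio of `S.word l`. -/
def wordRatio (l : List ι) : ℝ := (l.map S.ratio).prod

@[simp] lemma wordRatio_nil : S.wordRatio [] = 1 := rfl

@[simp] lemma wordRatio_cons (i : ι) (l : List ι) :
    S.wordRatio (i :: l) = S.ratio i * S.wordRatio l := by simp [wordRatio]

lemma dist_word (l : List ι) (x y : K) :
    dist (S.word l x) (S.word l y) = S.wordRatio l * dist x y := by
  induction l with
  | nil => simp [word]
  | cons i l ih => simp [word, S.dist_map, ih, mul_assoc]

lemma wordRatio_pos (l : List ι) : 0 < S.wordRatio l := by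
  induction l with
  | nil => simp
  | cons i l ih => simpa using mul_pos (S.ratio_pos i) ih

lemma wordRatio_le_one (l : List ι) : S.wordRatio l ≤ 1 := by
  induction l with
  | nil => simp
  | cons i l ih =>
    simpa using mul_le_one₀ (S.ratio_lt_one i).le (S.wordRatio_pos l).le ih

lemma wordRatio_le_pow {ρ : ℝ} (hρ0 : 0 ≤ ρ) (hρ : ∀ i, S.ratio i ≤ ρ) (l : List ι) :
    S.wordRatio l ≤ ρ ^ l.length := by
  induction l with
  | nil => simp
  | cons i l ih =>
    simpa [pow_succ'] using mul_le_mul (hρ i) ih (S.wordRatio_pos l).le hρ0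

lemma word_append (l l' : List ι) (x : K) : S.word (l ++ l') x = S.word l (S.word l' x) := by
  induction l with
  | nil => simp [word]
  | cons i l ih => simp [word, ih]

lemma continuous_word (l : List ι) : Continuous (S.word l) :=
  (LipschitzWith.of_dist_le_mul (K := ⟨S.wordRatio l, (S.wordRatio_pos l).le⟩)
    fun x y => (S.dist_word l x y).le).continuous

/-- Each common leading letter scales distances by its ratio; at the first differing letter the full
gap is available. -/
lemma gap_mul_wordRatio_le_dist {l : List ι} {y : K} (hy : y ∉ range (S.word l)) (x : K) :
    S.gap * S.wordRatio l ≤ dist (S.word l x) y := by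
  induction l generalizing y with
  | nil => simp [word] at hy
  | cons i l ih =>
    obtain ⟨j, z, rfl⟩ := S.exists_map_eq y
    by_cases hij : i = j
    · subst hij
      have hz : z ∉ range (S.word l) := by
        rintro ⟨u, rfl⟩
        exact hy ⟨u, rfl⟩
      calc S.gap * S.wordRatio (i :: l) = S.ratio i * (S.gap * S.wordRatio l) := by
            rw [wordRatio_cons]; ring
        _ ≤ S.ratio i * dist (S.word l x) z :=
            mul_le_mul_of_nonneg_left (ih hz) (S.ratio_pos i).le
        _ = _ := by simp [word, S.dist_map]
    · calc S.gap * S.wordRatio (i :: l) ≤ S.gap * 1 :=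
            mul_le_mul_of_nonneg_left (S.wordRatio_le_one _) S.gap_pos.le
        _ ≤ _ := by rw [mul_one]; exact S.gap_le i j hij _ _

lemma map_injective (i : ι) : Function.Injective (S.map i) := fun x y h => by
  have := S.dist_map i x y
  rw [h, dist_self] at this
  exact dist_eq_zero.1 ((mul_eq_zero.1 this.symm).resolve_left (S.ratio_pos i).ne')

lemma word_eq_word {l l' : List ι} (hl : l.length = l'.length) {x x' : K}
    (h : S.word l x = S.word l' x') : l = l' := by
  induction l generalizing l' with
  | nil => exact (List.length_eq_zero_iff.1 hl.symm).symm
  | cons i l ih =>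
    match l', hl with
    | j :: l', hl =>
      have hij : i = j := by
        by_contra hij
        have := S.gap_le i j hij (S.word l x) (S.word l' x')
        rw [show S.map i (S.word l x) = S.map j (S.word l' x') from h, dist_self] at this
        exact absurd S.gap_pos this.not_gt
      subst hij
      rw [ih (by simpa using hl) (S.map_injective i h)]

lemma exists_word_eq (x : K) (n : ℕ) :
    ∃ l : List ι, l.length = n ∧ ∃ y, S.word l y = x := by
  induction n generalizing x with
  | zero => exact ⟨[], rfl, x, rfl⟩
  | succ n ih =>
    obtain ⟨i, z, rfl⟩ := S.exists_map_eq x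
    obtain ⟨l, hl, y, rfl⟩ := ih z
    exact ⟨i :: l, by simp [hl], y, rfl⟩

lemma wordRatio_ofFn {n : ℕ} (w : Fin n → ι) :
    S.wordRatio (List.ofFn w) = ∏ k, S.ratio (w k) := by
  simp [wordRatio, List.prod_ofFn, List.map_ofFn]

lemma wordRatio_ofFn_rpow {n : ℕ} (w : Fin n → ι) (s : ℝ) :
    S.wordRatio (List.ofFn w) ^ s = ∏ k, S.ratio (w k) ^ s := by
  rw [wordRatio_ofFn, Real.finsetProd_rpow _ _ fun i _ => (S.ratio_pos _).le]

lemma ediam_range_word_le [CompactSpace K] (l : List ι) :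
    Metric.ediam (range (S.word l)) ≤
      ENNReal.ofReal (S.wordRatio l) * ENNReal.ofReal (Metric.diam (univ : Set K)) := by
  refine Metric.ediam_le ?_
  rintro _ ⟨x, rfl⟩ _ ⟨y, rfl⟩
  rw [edist_dist, dist_word, ENNReal.ofReal_mul (S.wordRatio_pos l).le]
  gcongr
  exact Metric.dist_le_diam_of_mem isCompact_univ.isBounded (mem_univ x) (mem_univ y)

lemma sum_wordRatio_rpow [Fintype ι] {s : ℝ} (hs : ∑ i, S.ratio i ^ s = 1) (n : ℕ) :
    ∑ w : Fin n → ι, S.wordRatio (List.ofFn w) ^ s = 1 := by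
  classical
  simp_rw [wordRatio_ofFn_rpow]
  rw [← Fintype.sum_pow (fun i => S.ratio i ^ s), hs, one_pow]

section Finite

variable [Finite ι] [Nonempty ι]

lemma exists_ratio_le : ∃ ρ : ℝ, 0 ≤ ρ ∧ ρ < 1 ∧ ∀ i, S.ratio i ≤ ρ := by
  obtain ⟨j, hj⟩ := Finite.exists_max S.ratio
  exact ⟨S.ratio j, (S.ratio_pos j).le, S.ratio_lt_one j, hj⟩

lemma exists_le_ratio : ∃ b : ℝ, 0 < b ∧ ∀ i, b ≤ S.ratio i := by
  obtain ⟨j, hj⟩ := Finite.exists_min S.ratio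
  exact ⟨S.ratio j, S.ratio_pos j, hj⟩

/-- Every point lies in a cylinder whose ratio is comparable to a given small scale. -/
lemma exists_word_scale {b : ℝ} (hb : ∀ i, b ≤ S.ratio i) (x : K) {t : ℝ} (ht : 0 < t)
    (htg : t < S.gap) :
    ∃ l y, S.word l y = x ∧ t < S.gap * S.wordRatio l ∧ S.gap * b * S.wordRatio l ≤ t := by
  obtain ⟨ρ, hρ0, hρ1, hρ⟩ := S.exists_ratio_le
  obtain ⟨n, hn⟩ := exists_pow_lt_of_lt_one (div_pos ht S.gap_pos) hρ1
  -- Lengthen the word towards `x` until one more letter would break the strict bound. The second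
  -- alternative is that this has not happened by length `n`; it fails once `ρ ^ n` drops below `t /
  -- gap`.
  have key : ∀ n : ℕ, (∃ l y, S.word l y = x ∧ t < S.gap * S.wordRatio l ∧
      S.gap * b * S.wordRatio l ≤ t) ∨
      ∃ l y, l.length = n ∧ S.word l y = x ∧ t < S.gap * S.wordRatio l := by
    intro n
    induction n with
    | zero => exact Or.inr ⟨[], x, rfl, rfl, by simpa⟩
    | succ n ih =>
      rcases ih with h | ⟨l, y, hl, hy, hlt⟩
      · exact Or.inl h
      · obtain ⟨i, z, rfl⟩ := S.exists_map_eq y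
        have hr : S.wordRatio (l ++ [i]) = S.wordRatio l * S.ratio i := by simp [wordRatio]
        by_cases hlt' : t < S.gap * S.wordRatio (l ++ [i])
        · exact Or.inr ⟨l ++ [i], z, by simp [hl], by rw [word_append]; exact hy, hlt'⟩
        · refine Or.inl ⟨l, _, hy, hlt, le_trans ?_ (not_lt.1 hlt')⟩
          rw [hr, mul_assoc, mul_comm b]
          exact mul_le_mul_of_nonneg_left
            (mul_le_mul_of_nonneg_left (hb i) (S.wordRatio_pos l).le) S.gap_pos.le
  rcases key n with h | ⟨l, y, hl, -, hlt⟩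
  · exact h
  · have h1 := S.wordRatio_le_pow hρ0 hρ l
    rw [hl] at h1
    have h2 := h1.trans_lt hn
    rw [lt_div_iff₀ S.gap_pos, mul_comm] at h2
    exact absurd hlt h2.not_gt

end Finite

/-! ### Similarity dimension and finiteness of Hausdorff measure -/

section Fintype

variable [Fintype ι] [Nonempty ι]

/-- The similarity dimension exists. -/
lemma exists_sum_rpow_eq_one : ∃ s : ℝ, 0 ≤ s ∧ ∑ i, S.ratio i ^ s = 1 := by
  have hcont : Continuous fun s : ℝ => ∑ i, S.ratio i ^ s :=
    continuous_finsetSum _ fun i _ => Real.continuous_const_rpow (S.ratio_pos i).ne'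
  have hlim : Tendsto (fun s : ℝ => ∑ i, S.ratio i ^ s) atTop (𝓝 0) := by
    rw [show (0 : ℝ) = ∑ _i : ι, (0 : ℝ) by simp]
    refine tendsto_finsetSum _ fun i _ => ?_
    exact tendsto_rpow_atTop_of_base_lt_one _ (by linarith [S.ratio_pos i]) (S.ratio_lt_one i)
  obtain ⟨t, ht1, ht0⟩ := ((hlim.eventually (gt_mem_nhds one_pos)).and (eventually_ge_atTop 0)).exists
  obtain ⟨s, hs, hs1⟩ := intermediate_value_Icc' ht0 hcont.continuousOn
    (show (1 : ℝ) ∈ Icc _ _ from ⟨ht1.le, by simpa using Nat.one_le_iff_ne_zero.2 Fintype.card_ne_zero⟩)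
  exact ⟨s, hs.1, hs1⟩

/-- The level-`n` cylinders form covers of vanishing mesh, and their `s`-sums are bounded by `D ^ s`
independently of `n`. -/
lemma hausdorffMeasure_univ_ne_top [CompactSpace K] [MeasurableSpace K] [BorelSpace K] {s : ℝ}
    (hs0 : 0 ≤ s) (hs : ∑ i, S.ratio i ^ s = 1) : μH[s] (univ : Set K) ≠ ⊤ := by
  obtain ⟨ρ, hρ0, hρ1, hρ⟩ := S.exists_ratio_le
  set D := Metric.diam (univ : Set K)
  have hle := Measure.hausdorffMeasure_le_liminf_sum s (univ : Set K) (l := atTop)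
    (fun n : ℕ => ENNReal.ofReal (ρ ^ n) * ENNReal.ofReal D)
    (by
      have : Tendsto (fun n : ℕ => ENNReal.ofReal (ρ ^ n * D)) atTop (𝓝 (ENNReal.ofReal (0 * D))) :=
        ENNReal.tendsto_ofReal ((tendsto_pow_atTop_nhds_zero_of_lt_one hρ0 hρ1).mul_const D)
      simpa [ENNReal.ofReal_mul (pow_nonneg hρ0 _)] using this)
    (fun n (w : Fin n → ι) => range (S.word (List.ofFn w)))
    (Eventually.of_forall fun n w => (S.ediam_range_word_le _).trans (by
      gcongr
      simpa using S.wordRatio_le_pow hρ0 hρ (List.ofFn w)))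
    (Eventually.of_forall fun n x _ => by
      obtain ⟨l, rfl, y, hy⟩ := S.exists_word_eq x n
      exact mem_iUnion.2 ⟨l.get, y, by rw [List.ofFn_get]; exact hy⟩)
  refine ne_top_of_le_ne_top (b := ENNReal.ofReal D ^ s)
    (ENNReal.rpow_ne_top_of_nonneg hs0 ENNReal.ofReal_ne_top) (hle.trans ?_)
  refine liminf_le_of_frequently_le' (Frequently.of_forall fun n => ?_)
  calc ∑ w : Fin n → ι, Metric.ediam (range (S.word (List.ofFn w))) ^ s
      ≤ ∑ w : Fin n → ι, ENNReal.ofReal (S.wordRatio (List.ofFn w) ^ s) * ENNReal.ofReal D ^ s := by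
        refine Finset.sum_le_sum fun w _ => ?_
        rw [← ENNReal.ofReal_rpow_of_pos (S.wordRatio_pos _), ← ENNReal.mul_rpow_of_nonneg _ _ hs0]
        exact ENNReal.rpow_le_rpow (S.ediam_range_word_le _) hs0
    _ = ENNReal.ofReal D ^ s := by
        rw [← Finset.sum_mul, ← ENNReal.ofReal_sum_of_nonneg
          fun w _ => Real.rpow_nonneg (S.wordRatio_pos _).le _, S.sum_wordRatio_rpow hs]
        simp

end Fintype

end SeparatedIFS

/-! ### Coding by sequences and positivity of Hausdorff measure -/

namespace SeparatedIFS

variable {ι K : Type*} [MetricSpace K] (S : SeparatedIFS ι K)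

lemma range_word_append_subset (l l' : List ι) :
    range (S.word (l ++ l')) ⊆ range (S.word l) := by
  rintro _ ⟨x, rfl⟩
  exact ⟨_, (S.word_append l l' x).symm⟩

variable [CompactSpace K]

lemma isClosed_range_word (l : List ι) : IsClosed (range (S.word l)) :=
  (isCompact_range (S.continuous_word l)).isClosed

lemma exists_forall_mem_range_word [Nonempty K] (ω : ℕ → ι) :
    ∃ x, ∀ n : ℕ, x ∈ range (S.word (List.ofFn fun k : Fin n => ω k)) := by
  have h := IsCompact.nonempty_iInter_of_sequence_nonempty_isCompact_isClosed
    (fun n : ℕ => range (S.word (List.ofFn fun k : Fin n => ω k)))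
    (fun n => by
      have : (List.ofFn fun k : Fin (n + 1) => ω k) =
          (List.ofFn fun k : Fin n => ω k) ++ [ω n] := by
        rw [List.ofFn_succ', List.concat_eq_append]; rfl
      simpa only [this] using S.range_word_append_subset _ _)
    (fun n => range_nonempty _) (isCompact_range (S.continuous_word _))
    (fun n => S.isClosed_range_word _)
  simpa [Set.Nonempty, mem_iInter] using h

/-- The point of `K` with a given address. -/
noncomputable def point [Nonempty K] (ω : ℕ → ι) : K :=
  (S.exists_forall_mem_range_word ω).choose

lemma point_mem [Nonempty K] (ω : ℕ → ι) (n : ℕ) :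
    S.point ω ∈ range (S.word (List.ofFn fun k : Fin n => ω k)) :=
  (S.exists_forall_mem_range_word ω).choose_spec n

lemma measurable_point [Nonempty K] [Finite ι] [Nonempty ι] [MeasurableSpace ι] [DiscreteMeasurableSpace ι]
    [MeasurableSpace K] [BorelSpace K] : Measurable S.point := by
  obtain ⟨ρ, hρ0, hρ1, hρ⟩ := S.exists_ratio_le
  obtain ⟨x₀⟩ := ‹Nonempty K›
  refine measurable_of_tendsto_metrizable
    (f := fun (n : ℕ) (ω : ℕ → ι) => S.word (List.ofFn fun k : Fin n => ω k) x₀) (fun n => ?_) ?_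
  · exact (Measurable.of_discrete (f := fun w : Fin n → ι => S.word (List.ofFn w) x₀)).comp
      (measurable_pi_lambda _ fun k => measurable_pi_apply _)
  · refine tendsto_pi_nhds.2 fun ω => tendsto_iff_dist_tendsto_zero.2 ?_
    refine squeeze_zero (fun _ => dist_nonneg) (g := fun n : ℕ => ρ ^ n * Metric.diam (univ : Set K))
      (fun n => ?_) ?_
    · obtain ⟨y, hy⟩ := S.point_mem ω n
      rw [← hy, dist_word]
      refine mul_le_mul ?_ ?_ dist_nonneg (pow_nonneg hρ0 _)
      · simpa using S.wordRatio_le_pow hρ0 hρ (List.ofFn fun k : Fin n => ω k)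
      · exact Metric.dist_le_diam_of_mem isCompact_univ.isBounded (mem_univ _) (mem_univ _)
    · simpa using (tendsto_pow_atTop_nhds_zero_of_lt_one hρ0 hρ1).mul_const
        (Metric.diam (univ : Set K))

/-- Addresses are unique, so only sequences starting with `l` can land in its cylinder. The guard on
`k` merely makes `l[k]` meaningful for a natural number index. -/
lemma point_preimage_subset [Nonempty K] (l : List ι) :
    S.point ⁻¹' range (S.word l) ⊆
      Set.pi (Finset.range l.length) fun k => {i | ∀ h : k < l.length, i = l[k]} := by
  rintro ω ⟨x, hx⟩ k hk h
  obtain ⟨y, hy⟩ := S.point_mem ω l.length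
  have := S.word_eq_word (by simp) (hx.trans hy.symm)
  have h2 := List.getElem_of_eq this h
  simpa using h2.symm

/-- The self-similar probability measure satisfies a Frostman estimate. -/
lemma exists_measure_le_ediam_rpow [Nonempty K] [Fintype ι] [Nonempty ι] [MeasurableSpace K]
    [BorelSpace K] {s : ℝ} (hs0 : 0 ≤ s) (hs : ∑ i, S.ratio i ^ s = 1) :
    ∃ (ν : Measure K) (D : ℝ), ν univ = 1 ∧ 0 < D ∧
      ∀ U : Set K, Metric.ediam U ≤ ENNReal.ofReal (S.gap / 2) →
        ν U ≤ ENNReal.ofReal D * Metric.ediam U ^ s := by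
  classical
  let _ : MeasurableSpace ι := ⊤
  let p : PMF ι := PMF.ofFintype (fun i => ENNReal.ofReal (S.ratio i ^ s)) (by
    rw [← ENNReal.ofReal_sum_of_nonneg fun i _ => Real.rpow_nonneg (S.ratio_pos _).le _, hs]; simp)
  -- Independent letters with weights `ratio i ^ s` give each cylinder mass at most its ratio to the
  -- power `s`.
  let P : Measure (ℕ → ι) := Measure.infinitePi fun _ => p.toMeasure
  obtain ⟨b, hb0, hb⟩ := S.exists_le_ratio
  have hmeas := S.measurable_point
  have hcyl : ∀ l, P.map S.point (range (S.word l)) ≤ ENNReal.ofReal (S.wordRatio l ^ s) := by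
    intro l
    rw [Measure.map_apply hmeas (S.isClosed_range_word l).measurableSet]
    refine (measure_mono (S.point_preimage_subset l)).trans ?_
    rw [Measure.infinitePi_pi _ fun _ _ => MeasurableSet.of_discrete,
      Finset.prod_range]
    have : ∀ k : Fin l.length, p.toMeasure {i | ∀ h : (k : ℕ) < l.length, i = l[(k : ℕ)]} =
        ENNReal.ofReal (S.ratio (l.get k) ^ s) := by
      intro k
      have : {i | ∀ h : (k : ℕ) < l.length, i = l[(k : ℕ)]} = {l.get k} := by
        ext i; simp [k.2]
      rw [this, p.toMeasure_apply_singleton _ (MeasurableSet.singleton _)]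
      simp [p]
    rw [Finset.prod_congr rfl fun k _ => this k,
      ← ENNReal.ofReal_prod_of_nonneg fun i _ => Real.rpow_nonneg (S.ratio_pos _).le _,
      ← S.wordRatio_ofFn_rpow, List.ofFn_get]
  have hgb : 0 < S.gap * b := mul_pos S.gap_pos hb0
  refine ⟨P.map S.point, ((S.gap * b) ^ s)⁻¹, ?_, inv_pos.2 (Real.rpow_pos_of_pos hgb _), ?_⟩
  · rw [Measure.map_apply hmeas MeasurableSet.univ, preimage_univ, measure_univ]
  intro U hU
  rcases U.eq_empty_or_nonempty with rfl | ⟨x, hx⟩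
  · simp
  have hUtop : Metric.ediam U ≠ ⊤ := ne_top_of_le_ne_top ENNReal.ofReal_ne_top hU
  have hdiam : Metric.diam U < S.gap := by
    have := ENNReal.toReal_mono ENNReal.ofReal_ne_top hU
    rw [ENNReal.toReal_ofReal (half_pos S.gap_pos).le] at this
    exact this.trans_lt (half_lt_self S.gap_pos)
  -- The diameter may be `0`, so the scale `t` is taken strictly above it and then decreased to it.
  have hbound : ∀ t, Metric.diam U < t → t < S.gap →
      P.map S.point U ≤ ENNReal.ofReal ((t / (S.gap * b)) ^ s) := by
    intro t ht htg
    obtain ⟨l, y, rfl, hlt, hle⟩ := S.exists_word_scale hb x (Metric.diam_nonneg.trans_lt ht) htg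
    have hsub : U ⊆ range (S.word l) := by
      intro z hz
      by_contra hzl
      have h1 := S.gap_mul_wordRatio_le_dist hzl y
      have h2 := Metric.dist_le_diam_of_mem' hUtop hx hz
      linarith
    refine (measure_mono hsub).trans ((hcyl l).trans (ENNReal.ofReal_le_ofReal ?_))
    refine Real.rpow_le_rpow (S.wordRatio_pos l).le ?_ hs0
    rwa [le_div_iff₀ hgb, mul_comm]
  have hlim : Tendsto (fun t : ℝ => ENNReal.ofReal ((t / (S.gap * b)) ^ s))
      (𝓝[>] (Metric.diam U)) (𝓝 (ENNReal.ofReal ((Metric.diam U / (S.gap * b)) ^ s))) :=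
    ((ENNReal.continuous_ofReal.comp ((Real.continuous_rpow_const hs0).comp
      (continuous_id.div_const _))).tendsto _).mono_left nhdsWithin_le_nhds
  refine (ge_of_tendsto hlim ?_).trans_eq ?_
  · filter_upwards [Ioo_mem_nhdsGT hdiam] with t ht using hbound t ht.1 ht.2
  · rw [Real.div_rpow Metric.diam_nonneg hgb.le, div_eq_inv_mul,
      ENNReal.ofReal_mul (inv_nonneg.2 (Real.rpow_nonneg hgb.le _)),
      ← ENNReal.ofReal_rpow_of_nonneg Metric.diam_nonneg hs0, Metric.diam,
      ENNReal.ofReal_toReal hUtop]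

variable [MeasurableSpace K] [BorelSpace K]

/-- Mass distribution principle: the Frostman measure divided by `D` is dominated by `μH[s]`. -/
lemma hausdorffMeasure_univ_ne_zero [Nonempty K] [Fintype ι] [Nonempty ι] {s : ℝ} (hs0 : 0 ≤ s)
    (hs : ∑ i, S.ratio i ^ s = 1) : μH[s] (univ : Set K) ≠ 0 := by
  obtain ⟨ν, D, hν, hD, hle⟩ := S.exists_measure_le_ediam_rpow hs0 hs
  have hD0 : ENNReal.ofReal D ≠ 0 := by simpa using hD
  have h := Measure.le_hausdorffMeasure s ((ENNReal.ofReal D)⁻¹ • ν) (ENNReal.ofReal (S.gap / 2))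
    (by simpa using S.gap_pos) fun U hU => by
      rw [Measure.smul_apply, smul_eq_mul, mul_comm, ← div_eq_mul_inv]
      exact ENNReal.div_le_of_le_mul' (hle U hU)
  have := h univ
  rw [Measure.smul_apply, hν, smul_eq_mul, mul_one] at this
  exact (lt_of_lt_of_le (ENNReal.inv_pos.2 ENNReal.ofReal_ne_top) this).ne'

lemma dimH_univ [Nonempty K] [Fintype ι] [Nonempty ι] {s : ℝ} (hs0 : 0 ≤ s)
    (hs : ∑ i, S.ratio i ^ s = 1) : (dimH (univ : Set K)).toReal = s := by
  have := dimH_of_hausdorffMeasure_ne_zero_ne_top (d := ⟨s, hs0⟩)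
    (S.hausdorffMeasure_univ_ne_zero hs0 hs) (S.hausdorffMeasure_univ_ne_top hs0 hs)
  rw [this]; rfl

/-- Every nonempty open set contains a cylinder, a scaled copy of the whole space. -/
lemma isOpenPosMeasure_hausdorffMeasure [Nonempty K] [Fintype ι] [Nonempty ι] {s : ℝ}
    (hs0 : 0 ≤ s) (hs : ∑ i, S.ratio i ^ s = 1) : (μH[s] : Measure K).IsOpenPosMeasure := by
  refine ⟨fun U hU ⟨x, hx⟩ h0 => ?_⟩
  obtain ⟨ε, hε, hball⟩ := Metric.isOpen_iff.1 hU x hx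
  obtain ⟨ρ, hρ0, hρ1, hρ⟩ := S.exists_ratio_le
  have hlim : Tendsto (fun n : ℕ => ρ ^ n * Metric.diam (univ : Set K)) atTop (𝓝 0) := by
    simpa using (tendsto_pow_atTop_nhds_zero_of_lt_one hρ0 hρ1).mul_const
      (Metric.diam (univ : Set K))
  obtain ⟨n, hn⟩ := (hlim.eventually (gt_mem_nhds hε)).exists
  obtain ⟨l, rfl, y, rfl⟩ := S.exists_word_eq x n
  have hsub : S.word l '' univ ⊆ U := by
    rintro _ ⟨z, -, rfl⟩
    apply hball
    rw [Metric.mem_ball, dist_word]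
    refine lt_of_le_of_lt ?_ hn
    exact mul_le_mul (S.wordRatio_le_pow hρ0 hρ l)
      (Metric.dist_le_diam_of_mem isCompact_univ.isBounded (mem_univ _) (mem_univ _))
      dist_nonneg (pow_nonneg hρ0 _)
  have hanti : AntilipschitzWith ⟨(S.wordRatio l)⁻¹, (inv_pos.2 (S.wordRatio_pos l)).le⟩
      (S.word l) := AntilipschitzWith.of_le_mul_dist fun u v => by
    rw [dist_word]
    exact (inv_mul_cancel_left₀ (S.wordRatio_pos l).ne' _).ge
  have := hanti.le_hausdorffMeasure_image hs0 univ
  rw [measure_mono_null hsub h0, mul_zero] at this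
  exact S.hausdorffMeasure_univ_ne_zero hs0 hs (le_antisymm this bot_le)

end SeparatedIFS

/-! ### Sequential compactness of the Fell topology -/

section Fell

variable {X : Type*} [TopologicalSpace X]

lemma tendsto_fellTopology_iff {A : ℕ → Closeds X} {F : Closeds X} :
    Tendsto A atTop (@nhds _ (fellTopology X) F) ↔
      (∀ K : Set X, IsCompact K → (F : Set X) ∩ K = ∅ → ∀ᶠ k in atTop, (A k : Set X) ∩ K = ∅) ∧
      ∀ G : Set X, IsOpen G → ((F : Set X) ∩ G).Nonempty →
        ∀ᶠ k in atTop, ((A k : Set X) ∩ G).Nonempty := by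
  rw [tendsto_nhds_generateFrom_iff]
  constructor
  · intro h
    exact ⟨fun K hK hF => h _ (Or.inl ⟨K, hK, rfl⟩) hF, fun G hG hF => h _ (Or.inr ⟨G, hG, rfl⟩) hF⟩
  · rintro ⟨h1, h2⟩ _ (⟨K, hK, rfl⟩ | ⟨G, hG, rfl⟩) hF
    exacts [h1 K hK hF, h2 G hG hF]

/-- Every sequence of closed sets has a subsequence that converges in the Fell topology. -/
lemma exists_subseq_tendsto_fellTopology [SecondCountableTopology X] (A : ℕ → Closeds X) :
    ∃ (F : Closeds X) (θ : ℕ → ℕ), StrictMono θ ∧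
      Tendsto (A ∘ θ) atTop (@nhds _ (fellTopology X) F) := by
  classical
  have hbasis := isBasis_countableBasis X
  have : Countable (countableBasis X) := (countable_countableBasis X).to_subtype
  -- Which basic open sets are hit is encoded as a point of a countable product of copies of `Bool`,
  -- where a subsequence converges.
  obtain ⟨h, θ, hθ, hlim⟩ := CompactSpace.tendsto_subseq
    (fun k (B : countableBasis X) => decide ((A k : Set X) ∩ B).Nonempty)
  have hlim' : ∀ B : countableBasis X,
      ∀ᶠ k in atTop, decide ((A (θ k) : Set X) ∩ B).Nonempty = h B := fun B => by
    have := (tendsto_pi_nhds.1 hlim B)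
    rw [nhds_discrete, tendsto_pure] at this
    exact this
  have hfalse : ∀ B : countableBasis X, h B = false →
      ∀ᶠ k in atTop, (A (θ k) : Set X) ∩ B = ∅ := fun B hB => by
    filter_upwards [hlim' B] with k hk
    rw [hB, decide_eq_false_iff_not, not_nonempty_iff_eq_empty] at hk
    exact hk
  let F : Closeds X := ⟨{y | ∀ B : countableBasis X, y ∈ (B : Set X) → h B = true}, by
    refine isOpen_compl_iff.1 (isOpen_iff_mem_nhds.2 fun y hy => ?_)
    simp only [mem_compl_iff, mem_ofPred_eq, not_forall] at hy
    obtain ⟨B, hyB, hB⟩ := hy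
    filter_upwards [(hbasis.isOpen B.2).mem_nhds hyB] with z hz hz'
    exact hB (hz' B hz)⟩
  refine ⟨F, θ, hθ, tendsto_fellTopology_iff.2 ⟨fun K hK hF => ?_, fun G hG hF => ?_⟩⟩
  · have hcov : ∀ y ∈ K, ∃ U ∈ 𝓝[K] y, ∀ᶠ k in atTop, (A (θ k) : Set X) ∩ U = ∅ := by
      intro y hy
      have hyF : ¬ ∀ B : countableBasis X, y ∈ (B : Set X) → h B = true := fun hyF =>
        (eq_empty_iff_forall_notMem.1 hF y) ⟨hyF, hy⟩
      push Not at hyF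
      obtain ⟨B, hyB, hB⟩ := hyF
      exact ⟨B, mem_nhdsWithin_of_mem_nhds ((hbasis.isOpen B.2).mem_nhds hyB),
        hfalse B (by simpa using hB)⟩
    refine hK.induction_on (p := fun U => ∀ᶠ k in atTop, (A (θ k) : Set X) ∩ U = ∅) ?_ ?_ ?_ hcov
    · simp
    · intro U V hUV hV
      filter_upwards [hV] with k hk
      exact subset_empty_iff.1 ((inter_subset_inter_right _ hUV).trans hk.subset)
    · intro U V hU hV
      filter_upwards [hU, hV] with k hk hk'
      rw [inter_union_distrib_left, hk, hk', union_empty]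
  · obtain ⟨y, hyF, hyG⟩ := hF
    obtain ⟨B, hB, hyB, hBG⟩ := hbasis.exists_subset_of_mem_open hyG hG
    filter_upwards [hlim' ⟨B, hB⟩] with k hk
    rw [hyF ⟨B, hB⟩ hyB, decide_eq_true_iff] at hk
    exact hk.mono (inter_subset_inter_right _ hBG)

end Fell

/-! ### Hausdorff measure under similarities -/

section Scaling

open scoped Pointwise

variable {K E : Type*} [MetricSpace K] [MeasurableSpace K] [BorelSpace K]
  [NormedAddCommGroup E] [NormedSpace ℝ E] [MeasurableSpace E] [BorelSpace E]

lemma continuous_of_dist_eq {X Y : Type*} [MetricSpace X] [MetricSpace Y] {g : X → Y} {r : ℝ}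
    (hg : ∀ u v, dist (g u) (g v) = r * dist u v) : Continuous g := by
  refine (LipschitzWith.of_dist_le_mul (K := r.toNNReal) fun u v => ?_).continuous
  rw [hg]
  exact mul_le_mul_of_nonneg_right (Real.le_coe_toNNReal r) dist_nonneg

/-- A map that scales distances by `r` maps Hausdorff measure to a multiple of the Hausdorff measure
on its range. -/
lemma hausdorffMeasure_restrict_range {g : K → E} {r : ℝ} (hr : 0 < r)
    (hg : ∀ u v, dist (g u) (g v) = r * dist u v) {s : ℝ} (hs : 0 ≤ s) :
    (μH[s] : Measure E).restrict (range g) = ENNReal.ofReal (r ^ s) • (μH[s] : Measure K).map g := by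
  have hcont := continuous_of_dist_eq hg
  have hiso : Isometry fun u => r⁻¹ • g u := Isometry.of_dist_eq fun u v => by
    rw [dist_smul₀, hg, norm_inv, Real.norm_of_nonneg hr.le, inv_mul_cancel_left₀ hr.ne']
  have himage : ∀ A : Set K, μH[s] (g '' A) = ENNReal.ofReal (r ^ s) * μH[s] A := by
    intro A
    have h1 : g '' A = r • ((fun u => r⁻¹ • g u) '' A) := by
      rw [← image_smul, image_image]
      simp [smul_smul, hr.ne']
    rw [h1, Measure.hausdorffMeasure_smul₀ hs hr.ne', hiso.hausdorffMeasure_image (Or.inl hs),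
      ENNReal.smul_def, smul_eq_mul, ← ENNReal.ofReal_coe_nnreal]
    simp [abs_of_pos hr]
  ext A hA
  rw [Measure.restrict_apply hA, Measure.smul_apply, Measure.map_apply hcont.measurable hA,
    smul_eq_mul, ← himage, image_preimage_eq_inter_range]

end Scaling

/-! ### Sets locally similar to a fixed compact space -/

section LocalCopies

variable {E : Type*} [NormedAddCommGroup E]

/-- On every ball around `0`, all but finitely many of the sets `A k` agree with a similar copy of
`K` through `0`, the similarity ratios being bounded and bounded away from `0`. -/
def HasLocalCopies (K : Type*) [MetricSpace K] (A : ℕ → Closeds E) : Prop :=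
  ∀ R : ℝ, 0 < R → ∃ a b : ℝ, 0 < a ∧ ∀ᶠ k in atTop, ∃ (r : ℝ) (g : K → E) (c : K),
    r ∈ Icc a b ∧ (∀ u v, dist (g u) (g v) = r * dist u v) ∧ g c = 0 ∧
      (A k : Set E) ∩ Metric.ball 0 R = range g ∩ Metric.ball 0 R

variable {K : Type*} [MetricSpace K]

lemma HasLocalCopies.comp {A : ℕ → Closeds E} (hA : HasLocalCopies K A) {θ : ℕ → ℕ}
    (hθ : Tendsto θ atTop atTop) : HasLocalCopies K (A ∘ θ) := fun R hR => by
  obtain ⟨a, b, ha, h⟩ := hA R hR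
  exact ⟨a, b, ha, hθ.eventually h⟩

variable [CompactSpace K]

lemma exists_eq_of_tendstoUniformly {g : ℕ → K → E} {g' : K → E} (hcont : Continuous g')
    (hg : TendstoUniformly g g' atTop) {y : E}
    (hy : ∀ ε > 0, ∃ᶠ k in atTop, ∃ u, dist (g k u) y < ε) : y ∈ range g' := by
  rw [← (isCompact_range hcont).isClosed.closure_eq]
  refine Metric.mem_closure_range_iff.2 fun ε hε => ?_
  obtain ⟨k, ⟨u, hu⟩, hk⟩ := ((hy (ε / 2) (half_pos hε)).and_eventually
    (Metric.tendstoUniformly_iff.1 hg (ε / 2) (half_pos hε))).exists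
  refine ⟨u, ?_⟩
  rw [dist_comm]
  calc dist (g' u) y ≤ dist (g' u) (g k u) + dist (g k u) y := dist_triangle _ _ _
    _ < ε := by linarith [hk u]

variable [ProperSpace E]

/-- Compactness of the set of similarities through the origin with ratios in a compact interval. -/
lemma exists_subseq_tendstoUniformly {a b : ℝ} (ha : 0 < a) {r : ℕ → ℝ} (hr : ∀ k, r k ∈ Icc a b)
    {g : ℕ → K → E} (hg : ∀ k u v, dist (g k u) (g k v) = r k * dist u v) {c : ℕ → K}
    (hc : ∀ k, g k (c k) = 0) :
    ∃ (θ : ℕ → ℕ) (r' : ℝ) (g' : K → E), StrictMono θ ∧ r' ∈ Icc a b ∧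
      Tendsto (r ∘ θ) atTop (𝓝 r') ∧ (∀ u v, dist (g' u) (g' v) = r' * dist u v) ∧
      TendstoUniformly (fun k => g (θ k)) g' atTop := by
  let G : ℕ → BoundedContinuousFunction K E := fun k =>
    BoundedContinuousFunction.mkOfCompact ⟨g k, continuous_of_dist_eq (hg k)⟩
  -- Since `g k` vanishes at `c k`, its values have norm at most `b` times the diameter of `K`;
  -- equicontinuity comes from the common Lipschitz constant.
  have hG : IsCompact (closure (range G)) := by
    refine BoundedContinuousFunction.arzela_ascoli
      (Metric.closedBall 0 (b * Metric.diam (univ : Set K))) (isCompact_closedBall _ _) _ ?_ ?_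
    · rintro _ u ⟨k, rfl⟩
      change dist (g k u) 0 ≤ _
      rw [← hc k, hg]
      exact mul_le_mul (hr k).2
        (Metric.dist_le_diam_of_mem isCompact_univ.isBounded (mem_univ _) (mem_univ _)) dist_nonneg
        (ha.le.trans ((hr k).1.trans (hr k).2))
    · refine UniformEquicontinuous.equicontinuous
        (LipschitzWith.uniformEquicontinuous _ b.toNNReal ?_)
      rintro ⟨_, k, rfl⟩
      refine LipschitzWith.of_dist_le_mul fun u v => ?_
      change dist (g k u) (g k v) ≤ _
      rw [hg]
      exact mul_le_mul_of_nonneg_right ((hr k).2.trans (Real.le_coe_toNNReal b)) dist_nonneg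
  obtain ⟨r', hr', θ₁, hθ₁, hlim₁⟩ := isCompact_Icc.tendsto_subseq hr
  obtain ⟨G', -, θ₂, hθ₂, hlim₂⟩ :=
    hG.tendsto_subseq (x := G ∘ θ₁) fun k => subset_closure (mem_range_self _)
  have hr₂ : Tendsto (r ∘ θ₁ ∘ θ₂) atTop (𝓝 r') := hlim₁.comp hθ₂.tendsto_atTop
  have hunif : TendstoUniformly (fun k => g ((θ₁ ∘ θ₂) k)) G' atTop :=
    BoundedContinuousFunction.tendsto_iff_tendstoUniformly.1 hlim₂
  refine ⟨θ₁ ∘ θ₂, r', G', hθ₁.comp hθ₂, hr', hr₂, fun u v => ?_, hunif⟩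
  refine tendsto_nhds_unique ((hunif.tendsto_at u).dist (hunif.tendsto_at v)) ?_
  simp_rw [hg]
  exact hr₂.mul_const _

/-- Hitting small balls puts points of `F` in the closed range of `g'`. Conversely, a point `g' u`
of the ball outside `F` would have a compact neighbourhood eventually missed by `A k`, though `g k
u` enters it. -/
lemma inter_ball_eq_of_tendsto_fellTopology {A : ℕ → Closeds E} {F : Closeds E}
    (hF : Tendsto A atTop (@nhds _ (fellTopology E) F)) {R : ℝ} {g : ℕ → K → E} {g' : K → E}
    (hcont : Continuous g') (hg : TendstoUniformly g g' atTop)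
    (hA : ∀ k, (A k : Set E) ∩ Metric.ball 0 R = range (g k) ∩ Metric.ball 0 R) :
    (F : Set E) ∩ Metric.ball 0 R = range g' ∩ Metric.ball 0 R := by
  obtain ⟨hmiss, hhit⟩ := tendsto_fellTopology_iff.1 hF
  refine Subset.antisymm ?_ ?_
  · rintro y ⟨hyF, hyR⟩
    refine ⟨exists_eq_of_tendstoUniformly hcont hg fun ε hε => Eventually.frequently ?_, hyR⟩
    filter_upwards [hhit (Metric.ball y ε ∩ Metric.ball 0 R)
      (Metric.isOpen_ball.inter Metric.isOpen_ball) ⟨y, hyF, Metric.mem_ball_self hε, hyR⟩]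
      with k hk
    obtain ⟨z, hzA, hzy, hzR⟩ := hk
    obtain ⟨⟨u, rfl⟩, -⟩ := (hA k).subset ⟨hzA, hzR⟩
    exact ⟨u, hzy⟩
  · rintro _ ⟨⟨u, rfl⟩, hyR⟩
    refine ⟨?_, hyR⟩
    by_contra hyF
    obtain ⟨ε, hε, hball⟩ := Metric.nhds_basis_closedBall.mem_iff.1
      (F.isClosed.isOpen_compl.mem_nhds hyF)
    have h1 := hmiss _ (isCompact_closedBall (g' u) ε)
      (disjoint_iff_inter_eq_empty.1 (disjoint_left.2 fun z hz hz' => hball hz' hz))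
    have h2 := (hg.tendsto_at u).eventually (Metric.closedBall_mem_nhds _ hε)
    have h3 := (hg.tendsto_at u).eventually (Metric.isOpen_ball.mem_nhds hyR)
    obtain ⟨k, hk1, hk2, hk3⟩ := (h1.and (h2.and h3)).exists
    exact (eq_empty_iff_forall_notMem.1 hk1 (g k u))
      ⟨((hA k).superset ⟨mem_range_self _, hk3⟩).1, hk2⟩

/-- A Fell limit of sets with uniform local copies of `K` is locally a copy of `K`. -/
lemma HasLocalCopies.exists_limit {A : ℕ → Closeds E} {F : Closeds E} (hA : HasLocalCopies K A)
    (hF : Tendsto A atTop (@nhds _ (fellTopology E) F)) {R : ℝ} (hR : 0 < R) :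
    ∃ (θ : ℕ → ℕ) (r : ℕ → ℝ) (g : ℕ → K → E) (r' : ℝ) (g' : K → E), StrictMono θ ∧
      (∀ k, 0 < r k) ∧ (∀ k u v, dist (g k u) (g k v) = r k * dist u v) ∧
      (∀ k, (A (θ k) : Set E) ∩ Metric.ball 0 R = range (g k) ∩ Metric.ball 0 R) ∧
      Tendsto r atTop (𝓝 r') ∧ TendstoUniformly g g' atTop ∧
      0 < r' ∧ (∀ u v, dist (g' u) (g' v) = r' * dist u v) ∧ (∃ c, g' c = 0) ∧
      (F : Set E) ∩ Metric.ball 0 R = range g' ∩ Metric.ball 0 R := by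
  obtain ⟨a, b, ha, h⟩ := hA R hR
  obtain ⟨N, hN⟩ := eventually_atTop.1 h
  choose r g c hr hg hc hAg using fun k => hN (k + N) (Nat.le_add_left _ _)
  obtain ⟨θ, r', g', hθ, hr', hlim, hg', hunif⟩ := exists_subseq_tendstoUniformly ha hr hg hc
  have hθN : StrictMono fun k => θ k + N := fun i j hij => Nat.add_lt_add_right (hθ hij) N
  have hcont := continuous_of_dist_eq hg'
  refine ⟨fun k => θ k + N, r ∘ θ, fun k => g (θ k), r', g', hθN,
    fun k => ha.trans_le (hr _).1, fun k => hg _, fun k => hAg _, hlim, hunif,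
    ha.trans_le hr'.1, hg', ?_, ?_⟩
  · refine exists_eq_of_tendstoUniformly hcont hunif fun ε hε => Frequently.of_forall fun k => ?_
    exact ⟨c (θ k), by rw [hc, dist_self]; exact hε⟩
  · exact inter_ball_eq_of_tendsto_fellTopology (A := fun k => A (θ k + N))
      (hF.comp hθN.tendsto_atTop) hcont hunif fun k => hAg _

end LocalCopies

/-! ### Hausdorff measure on Fell limits -/

section Measure

lemma integral_restrict_eq_of_inter_ball_eq {E : Type*} [NormedAddCommGroup E]
    [MeasurableSpace E] {ν : Measure E}
    {B B' : Set E} (hB : MeasurableSet B)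
    (hB' : MeasurableSet B') {R : ℝ} (h : B ∩ Metric.ball 0 R = B' ∩ Metric.ball 0 R)
    {f : E → ℝ} (hf : ∀ y ∉ Metric.ball 0 R, f y = 0) :
    ∫ y, f y ∂(ν.restrict B) = ∫ y, f y ∂(ν.restrict B') := by
  rw [← integral_indicator hB, ← integral_indicator hB']
  congr 1
  ext y
  by_cases hy : y ∈ Metric.ball (0 : E) R
  · have : y ∈ B ↔ y ∈ B' :=
      ⟨fun hyB => (h.subset ⟨hyB, hy⟩).1, fun hyB => (h.superset ⟨hyB, hy⟩).1⟩
    by_cases hyB : y ∈ B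
    · rw [indicator_of_mem hyB, indicator_of_mem (this.1 hyB)]
    · rw [indicator_of_notMem hyB, indicator_of_notMem (mt this.2 hyB)]
  · rw [indicator_apply_eq_zero.2 fun _ => hf y hy, indicator_apply_eq_zero.2 fun _ => hf y hy]

variable {E : Type*} [NormedAddCommGroup E] [NormedSpace ℝ E] [MeasurableSpace E] [BorelSpace E]
  {K : Type*} [MetricSpace K] [MeasurableSpace K] [BorelSpace K]
  {A : ℕ → Closeds E} {F : Closeds E} {s : ℝ}

lemma integral_restrict_range {g : K → E} {r : ℝ} (hr : 0 < r)
    (hg : ∀ u v, dist (g u) (g v) = r * dist u v) (hs : 0 ≤ s) {f : E → ℝ} (hf : Continuous f) :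
    ∫ y, f y ∂((μH[s] : Measure E).restrict (range g)) =
      r ^ s * ∫ u, f (g u) ∂(μH[s] : Measure K) := by
  rw [hausdorffMeasure_restrict_range hr hg hs, integral_smul_measure,
    integral_map (continuous_of_dist_eq hg).measurable.aemeasurable
      hf.measurable.aestronglyMeasurable, smul_eq_mul,
    ENNReal.toReal_ofReal (Real.rpow_nonneg hr.le _)]

variable [ProperSpace E] [CompactSpace K]

lemma HasLocalCopies.isLocallyFiniteMeasure (hA : HasLocalCopies K A)
    (hF : Tendsto A atTop (@nhds _ (fellTopology E) F)) (hs : 0 ≤ s)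
    (hK : μH[s] (univ : Set K) ≠ ⊤) :
    IsLocallyFiniteMeasure ((μH[s] : Measure E).restrict F) := by
  refine ⟨fun y => ⟨Metric.ball 0 (‖y‖ + 1), Metric.isOpen_ball.mem_nhds (by simp), ?_⟩⟩
  obtain ⟨-, -, -, r, g, -, -, -, -, -, -, hr, hg, -, hFg⟩ :=
    hA.exists_limit hF (show 0 < ‖y‖ + 1 by positivity)
  rw [Measure.restrict_apply Metric.isOpen_ball.measurableSet, inter_comm, hFg]
  refine (measure_mono inter_subset_left).trans_lt ?_
  rw [← Measure.restrict_apply_univ, hausdorffMeasure_restrict_range hr hg hs,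
    Measure.smul_apply, Measure.map_apply (continuous_of_dist_eq hg).measurable MeasurableSet.univ]
  exact ENNReal.mul_lt_top ENNReal.ofReal_lt_top hK.lt_top

/-- The local copy passes through `0`, so the unit ball pulls back to a nonempty open subset of `K`.
-/
lemma HasLocalCopies.restrict_ne_zero (hA : HasLocalCopies K A)
    (hF : Tendsto A atTop (@nhds _ (fellTopology E) F)) (hs : 0 ≤ s)
    (hK : (μH[s] : Measure K).IsOpenPosMeasure) : (μH[s] : Measure E).restrict F ≠ 0 := by
  obtain ⟨-, -, -, r, g, -, -, -, -, -, -, hr, hg, ⟨c, hc⟩, hFg⟩ := hA.exists_limit hF one_pos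
  have hcont := continuous_of_dist_eq hg
  intro h0
  have h1 : ((μH[s] : Measure E).restrict (range g)) (Metric.ball 0 1) = 0 := by
    rw [Measure.restrict_apply Metric.isOpen_ball.measurableSet, inter_comm, ← hFg, inter_comm,
      ← Measure.restrict_apply Metric.isOpen_ball.measurableSet, h0]
    rfl
  rw [hausdorffMeasure_restrict_range hr hg hs, Measure.smul_apply,
    Measure.map_apply hcont.measurable Metric.isOpen_ball.measurableSet, smul_eq_mul, mul_eq_zero,
    ENNReal.ofReal_eq_zero] at h1
  rcases h1 with h1 | h1
  · exact (Real.rpow_pos_of_pos hr s).not_ge h1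
  · exact (Metric.isOpen_ball.preimage hcont).measure_ne_zero _ ⟨c, by simp [hc]⟩ h1

/-- Fell convergence of locally similar sets implies weak convergence of Hausdorff measures. -/
lemma HasLocalCopies.tendsto_integral (hA : HasLocalCopies K A)
    (hF : Tendsto A atTop (@nhds _ (fellTopology E) F)) (hs : 0 ≤ s)
    (hK : μH[s] (univ : Set K) ≠ ⊤) {f : E → ℝ} (hf : Continuous f) (hfc : HasCompactSupport f) :
    Tendsto (fun k => ∫ y, f y ∂((μH[s] : Measure E).restrict (A k))) atTop
      (𝓝 (∫ y, f y ∂((μH[s] : Measure E).restrict F))) := by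
  obtain ⟨R, hR, hfR⟩ : ∃ R > 0, ∀ y ∉ Metric.ball (0 : E) R, f y = 0 := by
    obtain ⟨R, hR, hsub⟩ := hfc.isCompact.isBounded.subset_ball_lt 0 0
    exact ⟨R, hR, fun y hy => image_eq_zero_of_notMem_tsupport fun h => hy (hsub h)⟩
  obtain ⟨M, hM⟩ := hf.bounded_above_of_compact_support hfc
  have : IsFiniteMeasure (μH[s] : Measure K) := ⟨hK.lt_top⟩
  -- The limiting similarity depends on the subsequence, but its range in the ball is always `F`, so
  -- all subsequential limits agree.
  refine tendsto_of_subseq_tendsto fun η hη => ?_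
  obtain ⟨θ, r, g, r', g', hθ, hr, hg, hAg, hlim, hunif, hr', hg', -, hFg⟩ :=
    (hA.comp hη).exists_limit (hF.comp hη) hR
  refine ⟨θ, ?_⟩
  rw [integral_restrict_eq_of_inter_ball_eq F.isClosed.measurableSet
    (isCompact_range (continuous_of_dist_eq hg')).isClosed.measurableSet hFg hfR,
    integral_restrict_range hr' hg' hs hf]
  have heq : ∀ k, ∫ y, f y ∂((μH[s] : Measure E).restrict (A (η (θ k)))) =
      r k ^ s * ∫ u, f (g k u) ∂(μH[s] : Measure K) := fun k => by
    rw [← integral_restrict_range (hr k) (hg k) hs hf]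
    exact integral_restrict_eq_of_inter_ball_eq (A _).isClosed.measurableSet
      (isCompact_range (continuous_of_dist_eq (hg k))).isClosed.measurableSet (hAg k) hfR
  simp_rw [heq]
  refine (hlim.rpow_const (Or.inl hr'.ne')).mul ?_
  refine tendsto_integral_of_dominated_convergence (fun _ => M)
    (fun k => (hf.comp (continuous_of_dist_eq (hg k))).measurable.aestronglyMeasurable)
    (integrable_const _) (fun k => Eventually.of_forall fun u => hM _)
    (Eventually.of_forall fun u => (hf.tendsto _).comp (hunif.tendsto_at u))

end Measure

/-! ### Proportionality of weak limits -/

section WeakLimits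

variable {E : Type*} [TopologicalSpace E] [T2Space E] [LocallyCompactSpace E] [MeasurableSpace E]
  [BorelSpace E]

/-- If `η k → η ≠ 0` and `t k • η k → ν ≠ 0` weakly, then `ν` is a positive multiple of `η`. -/
lemma exists_eq_smul_of_tendsto_smul {η : ℕ → Measure E} {η' ν : Measure E} [η'.Regular]
    [ν.Regular] (hη0 : η' ≠ 0) (hν0 : ν ≠ 0) {t : ℕ → ℝ≥0}
    (hη : ∀ f : E → ℝ, Continuous f → HasCompactSupport f →
      Tendsto (fun k => ∫ y, f y ∂(η k)) atTop (𝓝 (∫ y, f y ∂η')))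
    (hν : ∀ f : E → ℝ, Continuous f → HasCompactSupport f →
      Tendsto (fun k => ∫ y, f y ∂(t k • η k)) atTop (𝓝 (∫ y, f y ∂ν))) :
    ∃ c : ℝ≥0, 0 < c ∧ ν = c • η' := by
  have hν' : ∀ f : E → ℝ, Continuous f → HasCompactSupport f →
      Tendsto (fun k => (t k : ℝ) * ∫ y, f y ∂(η k)) atTop (𝓝 (∫ y, f y ∂ν)) := by
    intro f hf hfc
    simpa only [integral_smul_nnreal_measure, NNReal.smul_def, smul_eq_mul] using hν f hf hfc
  obtain ⟨f, hf⟩ : ∃ f : CompactlySupportedContinuousMap E ℝ, ∫ y, f y ∂η' ≠ 0 := by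
    by_contra! h
    exact hη0 (Measure.ext_of_integral_eq_on_compactlySupported fun f => by simp [h f])
  have hlim := hη f f.continuous f.hasCompactSupport
  -- One test function with nonzero `η'`-integral forces the scalars to converge.
  have ht : Tendsto (fun k => (t k : ℝ)) atTop (𝓝 ((∫ y, f y ∂ν) / ∫ y, f y ∂η')) := by
    refine ((hν' f f.continuous f.hasCompactSupport).div hlim hf).congr' ?_
    filter_upwards [hlim.eventually_ne hf] with k hk
    exact mul_div_cancel_right₀ _ hk
  obtain ⟨c, hc⟩ : ∃ c : ℝ≥0, (c : ℝ) = (∫ y, f y ∂ν) / ∫ y, f y ∂η' :=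
    ⟨⟨_, ge_of_tendsto' ht fun k => (t k).2⟩, rfl⟩
  rw [← hc] at ht
  have heq : ν = c • η' := Measure.ext_of_integral_eq_on_compactlySupported fun h => by
    rw [integral_smul_nnreal_measure, NNReal.smul_def, smul_eq_mul]
    exact tendsto_nhds_unique (hν' h h.continuous h.hasCompactSupport)
      (ht.mul (hη h h.continuous h.hasCompactSupport))
  refine ⟨c, pos_iff_ne_zero.2 ?_, heq⟩
  rintro rfl
  exact hν0 (by rw [heq, zero_smul])

end WeakLimits

/-! ### Blow-ups of the attractor -/

section BlowUp

variable {d : ℕ} {C : NonemptyCompacts (EuclideanSpace ℝ (Fin d))}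
  {x : EuclideanSpace ℝ (Fin d)}

lemma dist_inv_smul_sub (x u v : EuclideanSpace ℝ (Fin d)) {r : ℝ} (hr : 0 < r) :
    dist (r⁻¹ • (u - x)) (r⁻¹ • (v - x)) = r⁻¹ * dist u v := by
  rw [dist_smul₀, dist_sub_right, norm_inv, Real.norm_of_nonneg hr.le]

lemma blowUpMeasure_hausdorffMeasure_restrict (C : NonemptyCompacts (EuclideanSpace ℝ (Fin d)))
    (x : EuclideanSpace ℝ (Fin d)) {r : ℝ} (hr : 0 < r) {s : ℝ} (hs : 0 ≤ s) :
    blowUpMeasure ((μH[s] : Measure (EuclideanSpace ℝ (Fin d))).restrict C) x r =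
      r.toNNReal ^ s •
        (μH[s] : Measure (EuclideanSpace ℝ (Fin d))).restrict (blowUpSet C.toCloseds x r) := by
  have hrange : (blowUpSet C.toCloseds x r : Set (EuclideanSpace ℝ (Fin d))) =
      range fun u : C => r⁻¹ • ((u : EuclideanSpace ℝ (Fin d)) - x) := by
    change (fun y => r⁻¹ • (y - x)) '' (C : Set (EuclideanSpace ℝ (Fin d))) = _
    rw [image_eq_range]
    rfl
  have hcoe : (μH[s] : Measure (EuclideanSpace ℝ (Fin d))).restrict C =
      (μH[s] : Measure C).map (fun u : C => (u : EuclideanSpace ℝ (Fin d))) := by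
    have h := (isometry_subtype_coe (s := (C : Set (EuclideanSpace ℝ (Fin d))))).map_hausdorffMeasure
      (Or.inl hs)
    rw [Subtype.range_coe] at h
    exact h.symm
  rw [hrange, hausdorffMeasure_restrict_range (inv_pos.2 hr)
    (fun u v : C => dist_inv_smul_sub x u v hr) hs, blowUpMeasure, hcoe,
    Measure.map_map (by fun_prop) (by fun_prop), ENNReal.smul_def, smul_smul]
  have : ((r.toNNReal ^ s : ℝ≥0) : ENNReal) * ENNReal.ofReal (r⁻¹ ^ s) = 1 := by
    rw [ENNReal.ofReal, ← ENNReal.coe_mul, Real.toNNReal_rpow_of_nonneg (inv_nonneg.2 hr.le),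
      ← NNReal.mul_rpow, Real.toNNReal_inv, mul_inv_cancel₀ (by simpa using hr), NNReal.one_rpow]
    rfl
  rw [this, one_smul]
  rfl

/-- Blow-ups of an attractor satisfying strong separation are locally similar to the attractor. -/
lemma SeparatedIFS.hasLocalCopies_blowUpSet {ι : Type*} [Finite ι] [Nonempty ι]
    (S : SeparatedIFS ι C) (hx : x ∈ C) {r : ℕ → ℝ} (hr : ∀ k, 0 < r k)
    (hr0 : Tendsto r atTop (𝓝 0)) :
    HasLocalCopies C fun k => blowUpSet C.toCloseds x (r k) := by
  obtain ⟨b, hb0, hb⟩ := S.exists_le_ratio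
  have hgb : 0 < S.gap * b := mul_pos S.gap_pos hb0
  intro R hR
  -- These bounds are those of `exists_word_scale` at `t = R * r k`, divided by `r k`.
  refine ⟨R / S.gap, R / (S.gap * b), div_pos hR S.gap_pos, ?_⟩
  have hsmall : ∀ᶠ k in atTop, R * r k < S.gap := by
    have := hr0.const_mul R
    rw [mul_zero] at this
    exact this.eventually (gt_mem_nhds S.gap_pos)
  filter_upwards [hsmall] with k hk
  obtain ⟨l, c, hc, hlt, hle⟩ := S.exists_word_scale hb ⟨x, hx⟩ (mul_pos hR (hr k)) hk
  refine ⟨(r k)⁻¹ * S.wordRatio l, fun u => (r k)⁻¹ • ((S.word l u : EuclideanSpace ℝ (Fin d)) - x),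
    c, ⟨?_, ?_⟩, fun u v => ?_, ?_, ?_⟩
  · rw [div_le_iff₀ S.gap_pos, mul_assoc, ← div_eq_inv_mul, le_div_iff₀ (hr k), mul_comm _ S.gap]
    exact hlt.le
  · rw [le_div_iff₀ hgb, mul_assoc, ← div_eq_inv_mul, div_le_iff₀ (hr k), mul_comm _ (S.gap * b)]
    exact hle
  · rw [dist_inv_smul_sub x _ _ (hr k), mul_assoc, ← S.dist_word]
    rfl
  · simp [hc]
  · refine Subset.antisymm ?_ ?_
    · rintro _ ⟨⟨p, hp, rfl⟩, hpR⟩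
      refine ⟨?_, hpR⟩
      have hpx : dist x p < R * r k := by
        rw [mem_ball_zero_iff, norm_smul, norm_inv, Real.norm_of_nonneg (hr k).le,
          ← div_eq_inv_mul, div_lt_iff₀ (hr k)] at hpR
        rwa [dist_comm, dist_eq_norm]
      obtain ⟨u, hu⟩ : (⟨p, hp⟩ : C) ∈ range (S.word l) := by
        by_contra hnot
        have := S.gap_mul_wordRatio_le_dist hnot c
        rw [hc] at this
        exact (hlt.trans_le this).not_gt hpx
      exact ⟨u, by simp only [hu]⟩
    · rintro _ ⟨⟨u, rfl⟩, huR⟩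
      exact ⟨⟨_, (S.word l u).2, rfl⟩, huR⟩

/-- The system of the restrictions of the maps to the attractor. -/
lemma exists_separatedIFS {m : ℕ}
    {φ : Fin m → EuclideanSpace ℝ (Fin d) → EuclideanSpace ℝ (Fin d)}
    (hC : IsSelfSimilarSet φ C) (hsep : StrongSeparation φ C) : Nonempty (SeparatedIFS (Fin m) C) := by
  obtain ⟨hφ, hunion⟩ := hC
  choose ρ hρ0 hρ1 hρ using hφ
  have hmaps : ∀ i, MapsTo (φ i) C C := fun i y hy => by
    rw [hunion]
    exact mem_iUnion.2 ⟨i, mem_image_of_mem _ hy⟩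
  have hgap : ∀ q : Fin m × Fin m, ∃ δ > 0, q.1 ≠ q.2 → ∀ u ∈ (C : Set (EuclideanSpace ℝ (Fin d))),
      ∀ v ∈ (C : Set (EuclideanSpace ℝ (Fin d))), δ ≤ dist (φ q.1 u) (φ q.2 v) := by
    intro q
    by_cases hq : q.1 = q.2
    -- A dummy value on the diagonal; the minimum over all pairs stays positive.
    · exact ⟨1, one_pos, fun h => absurd hq h⟩
    · have hcompact : ∀ i, IsCompact (φ i '' (C : Set (EuclideanSpace ℝ (Fin d)))) := fun i =>
        C.isCompact.image (continuous_of_dist_eq (hρ i))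
      obtain ⟨δ, hδ, h⟩ := (hsep q.1 q.2 hq).exists_thickenings (hcompact _) (hcompact _).isClosed
      refine ⟨δ, hδ, fun _ u hu v hv => ?_⟩
      by_contra! hlt
      refine disjoint_left.1 h (?_ : φ q.2 v ∈ _) ?_
      · exact Metric.mem_thickening_iff.2 ⟨_, mem_image_of_mem _ hu, by rwa [dist_comm]⟩
      · exact Metric.self_subset_thickening hδ _ (mem_image_of_mem _ hv)
  choose δ hδ0 hδ using hgap
  obtain ⟨y₀, hy₀⟩ := C.nonempty
  rw [hunion] at hy₀
  obtain ⟨i₀, -⟩ := mem_iUnion.1 hy₀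
  have : Nonempty (Fin m × Fin m) := ⟨(i₀, i₀)⟩
  obtain ⟨q₀, hq₀⟩ := Finite.exists_min δ
  exact ⟨{
    map := fun i y => ⟨φ i y, hmaps i y.2⟩
    ratio := ρ
    ratio_pos := hρ0
    ratio_lt_one := hρ1
    dist_map := fun i x y => hρ i x y
    exists_map_eq := fun y => by
      have hy : (y : EuclideanSpace ℝ (Fin d)) ∈ (C : Set (EuclideanSpace ℝ (Fin d))) := y.2
      rw [hunion] at hy
      obtain ⟨i, z, hz, hzy⟩ := mem_iUnion.1 hy
      exact ⟨i, ⟨z, hz⟩, Subtype.ext hzy⟩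
    gap := δ q₀
    gap_pos := hδ0 q₀
    gap_le := fun i j hij x y => (hq₀ (i, j)).trans (hδ (i, j) hij x x.2 y y.2) }⟩

end BlowUp

/-! ### Tangent measures and limit models -/

theorem theorem1p1 {d m : ℕ}
    (φ : Fin m → EuclideanSpace ℝ (Fin d) → EuclideanSpace ℝ (Fin d))
    (C : NonemptyCompacts (EuclideanSpace ℝ (Fin d)))
    (hC : IsSelfSimilarSet φ C) (hsep : StrongSeparation φ C)
    (x : EuclideanSpace ℝ (Fin d)) (hx : x ∈ C) :
    tangentMeasures
        ((μH[(dimH (C : Set (EuclideanSpace ℝ (Fin d)))).toReal] :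
          Measure (EuclideanSpace ℝ (Fin d))).restrict C) x =
      {ν | ∃ F ∈ limitModels C.toCloseds x, ∃ c : ℝ≥0, 0 < c ∧
        ν = c • (μH[(dimH (C : Set (EuclideanSpace ℝ (Fin d)))).toReal] :
          Measure (EuclideanSpace ℝ (Fin d))).restrict F} := by
  obtain ⟨S⟩ := exists_separatedIFS hC hsep
  have : CompactSpace C := isCompact_iff_compactSpace.1 C.isCompact
  have : Nonempty C := C.nonempty.to_subtype
  have : Nonempty (Fin m) := ⟨(S.exists_map_eq (Classical.arbitrary C)).choose⟩
  obtain ⟨s, hs, hsum⟩ := S.exists_sum_rpow_eq_one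
  have hdim : (dimH (C : Set (EuclideanSpace ℝ (Fin d)))).toReal = s := by
    rw [← S.dimH_univ hs hsum, ← (isometry_subtype_coe
      (s := (C : Set (EuclideanSpace ℝ (Fin d))))).dimH_image univ, image_univ, Subtype.range_coe]
  rw [hdim]
  have hfin := S.hausdorffMeasure_univ_ne_top hs hsum
  have hpos := S.isOpenPosMeasure_hausdorffMeasure hs hsum
  have hreg : ∀ (c : ℝ≥0) (r : ℝ), (c • blowUpMeasure
      ((μH[s] : Measure (EuclideanSpace ℝ (Fin d))).restrict C) x r).Regular := by
    intro c r
    have : IsFiniteMeasure ((μH[s] : Measure (EuclideanSpace ℝ (Fin d))).restrict C) := by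
      have h := (isometry_subtype_coe
        (s := (C : Set (EuclideanSpace ℝ (Fin d))))).hausdorffMeasure_image (Or.inl hs) univ
      rw [image_univ, Subtype.range_coe] at h
      exact ⟨by rw [Measure.restrict_apply_univ, h]; exact hfin.lt_top⟩
    have : IsFiniteMeasure (blowUpMeasure
        ((μH[s] : Measure (EuclideanSpace ℝ (Fin d))).restrict C) x r) := by
      unfold blowUpMeasure; infer_instance
    infer_instance
  ext ν
  constructor
  · rintro ⟨hν0, r, c, hr, -, hr0, -, hνreg, hlim⟩
    obtain ⟨F, θ, hθ, hF⟩ :=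
      exists_subseq_tendsto_fellTopology fun k => blowUpSet C.toCloseds x (r k)
    have hlocal := (S.hasLocalCopies_blowUpSet hx hr hr0).comp hθ.tendsto_atTop
    have := hlocal.isLocallyFiniteMeasure hF hs hfin
    refine ⟨F, ⟨r ∘ θ, fun k => hr _, hr0.comp hθ.tendsto_atTop, hF⟩, ?_⟩
    refine exists_eq_smul_of_tendsto_smul (hlocal.restrict_ne_zero hF hs hpos) hν0
      -- The factor `r ^ s` passes from the blow-up of the measure to `μH[s]` on the blown-up set.
      (t := fun k => c (θ k) * (r (θ k)).toNNReal ^ s)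
      (fun f hf hfc => hlocal.tendsto_integral hF hs hfin hf hfc) fun f hf hfc => ?_
    have := (hlim f hf hfc).comp hθ.tendsto_atTop
    refine this.congr fun k => ?_
    simp only [Function.comp_apply]
    rw [blowUpMeasure_hausdorffMeasure_restrict C x (hr _) hs, smul_smul]
  · rintro ⟨F, ⟨r, hr, hr0, hF⟩, c, hc, rfl⟩
    have hlocal := S.hasLocalCopies_blowUpSet hx hr hr0
    have := hlocal.isLocallyFiniteMeasure hF hs hfin
    have hrs : ∀ k, 0 < (r k).toNNReal ^ s := fun k => NNReal.rpow_pos (by simpa using hr k)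
    refine ⟨?_, r, fun k => c * ((r k).toNNReal ^ s)⁻¹, hr, fun k => mul_pos hc (inv_pos.2 (hrs k)),
      hr0, fun k => hreg _ _, inferInstance, fun f hf hfc => ?_⟩
    · exact smul_ne_zero hc.ne' (hlocal.restrict_ne_zero hF hs hpos)
    · have heq : ∀ k, (c * ((r k).toNNReal ^ s)⁻¹) •
          blowUpMeasure ((μH[s] : Measure (EuclideanSpace ℝ (Fin d))).restrict C) x (r k) =
          c • (μH[s] : Measure (EuclideanSpace ℝ (Fin d))).restrict
            (blowUpSet C.toCloseds x (r k)) := fun k => by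
        rw [blowUpMeasure_hausdorffMeasure_restrict C x (hr k) hs, smul_smul, mul_assoc,
          inv_mul_cancel₀ (hrs k).ne', mul_one]
      simp only [heq, integral_smul_nnreal_measure]
      exact (hlocal.tendsto_integral hF hs hfin hf hfc).const_smul c
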